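/- Let $n\ge 1$ and let $\mathbb H$ denote Hamilton's quaternions. Let $\mathrm{Sp}(n,1)$ be the group of invertible matrices $A\in M_{n+1}(\mathbb H)$ preserving the Hermitian form of signature $(n,1)$ $$\langle z,w\rangle=\bar w_{n+1}z_1+\sum_{i=2}^{n}\bar w_i z_i+\bar w_1 z_{n+1}$$ on the right vector space $\mathbb H^{n+1}$, and let $\mathrm{PSp}(n,1)=\mathrm{Sp}(n,1)/\{\pm I\}$, with its usual Lie group topology. A pair $(g_1,g_2)$ of elements of a group $G$ is called strongly doubly reversible if there is $h\in G$ with $h^2=1$ and $hg_ih^{-1}=g_i^{-1}$ for $i=1,2$. Then the set of strongly doubly reversible pairs in $\mathrm{PSp}(n,1)\times \mathrm{PSp}(n,1)$ has Haar measure zero, i.e. it is a null set for every Haar measure on the group $\mathrm{PSp}(n,1)\times \mathrm{PSp}(n,1)$. -/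

import Mathlib

open scoped Quaternion Matrix

namespace QuatHyp

/-- The `(n+1) × (n+1)` matrix of the Hermitian form on `ℍ^{n,1}`: it exchanges the first and the
last coordinate and is the identity on the `n - 1` middle ones (signature `(n,1)` for `n ≥ 1`). -/
noncomputable def formMatrix (n : ℕ) : Matrix (Fin (n + 1)) (Fin (n + 1)) ℍ[ℝ] :=
  fun i j => if Equiv.swap 0 (Fin.last n) i = j then 1 else 0

/-- The Hermitian form `⟨z, w⟩ = w^* H z` on the right `ℍ`-vector space `ℍ^{n+1}`. -/
noncomputable def hermForm (n : ℕ) (z w : Fin (n + 1) → ℍ[ℝ]) : ℍ[ℝ] :=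
  star w ⬝ᵥ (formMatrix n *ᵥ z)

/-- `Sp(n,1)`: the invertible quaternionic matrices that preserve the Hermitian form. -/
def Sp (n : ℕ) : Subgroup (Matrix (Fin (n + 1)) (Fin (n + 1)) ℍ[ℝ])ˣ where
  carrier := {A | ∀ z w, hermForm n (A.val *ᵥ z) (A.val *ᵥ w) = hermForm n z w}
  one_mem' := by intro z w; simp
  mul_mem' := by
    intro A B hA hB z w
    have h := hA (B.val *ᵥ z) (B.val *ᵥ w)
    rw [Matrix.mulVec_mulVec, Matrix.mulVec_mulVec] at h
    exact h.trans (hB z w)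
  inv_mem' := by
    intro A hA z w
    have h := hA (A.inv *ᵥ z) (A.inv *ᵥ w)
    rw [Matrix.mulVec_mulVec, Matrix.mulVec_mulVec, A.val_inv, Matrix.one_mulVec,
      Matrix.one_mulVec] at h
    exact h.symm

/-- The matrix form of the definition. -/
theorem mem_Sp_iff (n : ℕ) (A : (Matrix (Fin (n + 1)) (Fin (n + 1)) ℍ[ℝ])ˣ) :
    A ∈ Sp n ↔ A.valᴴ * formMatrix n * A.val = formMatrix n := by
  have key : ∀ z w : Fin (n + 1) → ℍ[ℝ], hermForm n (A.val *ᵥ z) (A.val *ᵥ w)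
      = star w ⬝ᵥ ((A.valᴴ * formMatrix n * A.val) *ᵥ z) := by
    intro z w
    rw [hermForm, Matrix.star_mulVec, ← Matrix.dotProduct_mulVec, Matrix.mulVec_mulVec,
      Matrix.mulVec_mulVec, Matrix.mul_assoc]
  constructor
  · intro h
    ext1 i j
    have h1 := h (Pi.single j 1) (Pi.single i 1)
    rw [key, hermForm] at h1
    have hs : star (Pi.single i (1 : ℍ[ℝ]) : Fin (n + 1) → ℍ[ℝ]) = Pi.single i 1 := by
      rw [← Pi.single_star, star_one]
    simpa [hs] using h1
  · intro h z w
    rw [key, h, hermForm]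

theorem neg_one_mem_Sp (n : ℕ) : (-1 : (Matrix (Fin (n + 1)) (Fin (n + 1)) ℍ[ℝ])ˣ) ∈ Sp n := by
  rw [mem_Sp_iff]; simp

/-- The subgroup `{±I}` of `Sp(n,1)`. -/
def pmOne (n : ℕ) : Subgroup (Sp n) where
  carrier := {A | A = 1 ∨ A = ⟨-1, neg_one_mem_Sp n⟩}
  one_mem' := Or.inl rfl
  mul_mem' := by
    rintro A B (rfl | rfl) (rfl | rfl)
    · exact Or.inl (one_mul _)
    · exact Or.inr (one_mul _)
    · exact Or.inr (mul_one _)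
    · exact Or.inl (Subtype.ext (by simp))
  inv_mem' := by
    rintro A (rfl | rfl)
    · exact Or.inl inv_one
    · exact Or.inr (Subtype.ext (by simp))

instance pmOne_normal (n : ℕ) : (pmOne n).Normal where
  conj_mem := by
    rintro A (rfl | rfl) g
    · exact Or.inl (by simp)
    · exact Or.inr (Subtype.ext (by simp))

/-- `PSp(n,1) = Sp(n,1)/{±I}`, with the quotient of the subspace topology from matrices. -/
abbrev PSp (n : ℕ) : Type := Sp n ⧸ pmOne n

/-- `(g₁, g₂)` is strongly doubly reversible: some `h` with `h² = 1` conjugates each `gᵢ` to its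
inverse. -/
def StronglyDoublyReversible {G : Type*} [Group G] (g₁ g₂ : G) : Prop :=
  ∃ h : G, h ^ 2 = 1 ∧ h * g₁ * h⁻¹ = g₁⁻¹ ∧ h * g₂ * h⁻¹ = g₂⁻¹

end QuatHyp

/-! If `h² = 1` and `h gᵢ h⁻¹ = gᵢ⁻¹`, then `h gᵢ` also squares to one. Lifted to Sp(n,1), a
strongly doubly reversible pair therefore has the form `(H⁻¹K₁, H⁻¹K₂)` with `H`, `K₁`, `K₂` of
square `±1`, and the theorem is a dimension count.

Near such an `H`, the Cayley transform (`exists_cayley_eq`) parametrizes the unitary elements of the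
same square by skew `X` anticommuting with `H`. These form a space of real dimension at most
`(n+1)(n+2)`, by a trace computation (`finrank_antiPart_adj_le`). So the lifted pairs have Hausdorff
dimension at most `3(n+1)(n+2)`, less than the dimension `2(n+1)(2n+3)` of two copies of the Lie
algebra when `n ≥ 1`.

No manifold structure on the group is needed to conclude: `exp` is antilipschitz near `0`, so every
left translate of the set pulls back to a null set in a ball of the Lie algebra, and Fubini
(`haar_eq_zero_of_translates_null`) turns this into Haar nullity. -/

namespace QuatHyp

open MeasureTheory

/-! ### Real traces of maps on quaternionic matrices -/

section Trace

variable {ι : Type*} [Fintype ι]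

/-- The real basis `1, i, j, k` of the quaternions. -/
noncomputable def quaternionBasis : Module.Basis (Fin 4) ℝ ℍ[ℝ] :=
  QuaternionAlgebra.basisOneIJK (R := ℝ) (-1) 0 (-1)

theorem quaternionBasis_repr (q : ℍ[ℝ]) :
    ⇑(quaternionBasis.repr q) = ![q.re, q.imI, q.imJ, q.imK] := rfl

theorem quaternionBasis_components (k : Fin 4) :
    (quaternionBasis k).re = ![1, 0, 0, 0] k ∧ (quaternionBasis k).imI = ![0, 1, 0, 0] k ∧
      (quaternionBasis k).imJ = ![0, 0, 1, 0] k ∧ (quaternionBasis k).imK = ![0, 0, 0, 1] k := by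
  have h := quaternionBasis_repr (quaternionBasis k)
  rw [quaternionBasis.repr_self] at h
  have h0 := congrFun h 0
  have h1 := congrFun h 1
  have h2 := congrFun h 2
  have h3 := congrFun h 3
  simp only [Matrix.cons_val] at h0 h1 h2 h3
  rw [← h0, ← h1, ← h2, ← h3]
  fin_cases k <;> simp

theorem quaternionBasis_matrix_repr (A : Matrix ι ι ℍ[ℝ]) (i j : ι) (k : Fin 4) :
    (quaternionBasis.matrix ι ι).repr A (i, j, k) = quaternionBasis.repr (A i j) k := by
  rw [Module.Basis.matrix, Module.Basis.map_repr, LinearEquiv.trans_apply,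
    Module.Basis.repr_reindex_apply]
  exact (Pi.basis_repr (fun _ : ι => Pi.basis fun _ : ι => quaternionBasis) A ⟨i, ⟨j, k⟩⟩).trans
    (Pi.basis_repr (fun _ : ι => quaternionBasis) (A i) ⟨j, k⟩)

/-- The real part of quaternions as an additive homomorphism. -/
def quaternionRe : ℍ[ℝ] →+ ℝ where
  toFun q := q.re
  map_zero' := rfl
  map_add' _ _ := rfl

variable [DecidableEq ι]

/-- The real trace of an endomorphism of quaternionic matrices, computed entrywise. -/
theorem trace_matrix_quaternion (T : Matrix ι ι ℍ[ℝ] →ₗ[ℝ] Matrix ι ι ℍ[ℝ]) :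
    LinearMap.trace ℝ _ T = ∑ i, ∑ j, ∑ k,
      quaternionBasis.repr (T (Matrix.single i j (quaternionBasis k)) i j) k := by
  rw [LinearMap.trace_eq_matrix_trace ℝ (quaternionBasis.matrix ι ι)]
  simp only [Matrix.trace, Matrix.diag, LinearMap.toMatrix_apply, Fintype.sum_prod_type,
    Module.Basis.matrix_apply, quaternionBasis_matrix_repr]

theorem mul_single_mul_apply (A B : Matrix ι ι ℍ[ℝ]) (i j k l : ι) (q : ℍ[ℝ]) :
    (A * Matrix.single i j q * B) k l = A k i * q * B j l := by
  simp [Matrix.mul_apply, Matrix.single_apply, ite_and]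

/-- On each entry this is the trace of `q ↦ a q b` on `ℍ`, which is `4 Re a Re b`. -/
theorem trace_mul_mul (T : Matrix ι ι ℍ[ℝ] →ₗ[ℝ] Matrix ι ι ℍ[ℝ]) (A B : Matrix ι ι ℍ[ℝ])
    (hT : ∀ X, T X = A * X * B) :
    LinearMap.trace ℝ _ T = 4 * (A.trace.re * B.trace.re) := by
  have hre : ∀ C : Matrix ι ι ℍ[ℝ], C.trace.re = ∑ i, (C i i).re := fun C => by
    simp only [Matrix.trace, Matrix.diag]
    exact map_sum quaternionRe _ _
  rw [trace_matrix_quaternion, hre, hre, Finset.sum_mul_sum, Finset.mul_sum]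
  refine Finset.sum_congr rfl fun i _ => ?_
  rw [Finset.mul_sum]
  refine Finset.sum_congr rfl fun j _ => ?_
  simp only [hT, mul_single_mul_apply, quaternionBasis_repr, Fin.sum_univ_four]
  simp [quaternionBasis_components]
  ring

/-- On each entry this is the trace of `q ↦ a q̄ b` on `ℍ`, which is `-2 Re (ā b)`. -/
theorem trace_mul_conjTranspose_mul (T : Matrix ι ι ℍ[ℝ] →ₗ[ℝ] Matrix ι ι ℍ[ℝ])
    (A B : Matrix ι ι ℍ[ℝ]) (hT : ∀ X, T X = A * Xᴴ * B) :
    LinearMap.trace ℝ _ T = -2 * (Aᴴ * B).trace.re := by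
  have hre : (Aᴴ * B).trace.re = ∑ i, ∑ j, (star (A i j) * B i j).re := by
    rw [Finset.sum_comm]
    simp only [Matrix.trace, Matrix.diag, Matrix.mul_apply, Matrix.conjTranspose_apply]
    exact (map_sum quaternionRe _ _).trans
      (Finset.sum_congr rfl fun i _ => map_sum quaternionRe _ _)
  rw [trace_matrix_quaternion, hre, Finset.mul_sum]
  refine Finset.sum_congr rfl fun i _ => ?_
  rw [Finset.mul_sum]
  refine Finset.sum_congr rfl fun j _ => ?_
  simp only [hT, Matrix.conjTranspose_single, mul_single_mul_apply, quaternionBasis_repr,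
    Fin.sum_univ_four]
  simp [quaternionBasis_components]
  ring

end Trace

/-! ### Skew elements and involutions for a linear map `σ` -/

section Skew

variable {A : Type*} [Ring A] [Algebra ℝ A]

/-- The `-1`-eigenspace of a linear endomorphism `σ`. -/
def skewPart (σ : A →ₗ[ℝ] A) : Submodule ℝ A where
  carrier := {X | σ X = -X}
  zero_mem' := by simp
  add_mem' := by
    intro X Y hX hY
    change σ X = -X at hX
    change σ Y = -Y at hY
    change σ (X + Y) = -(X + Y)
    rw [map_add, hX, hY, neg_add]
  smul_mem' := by
    intro c X hX
    change σ X = -X at hX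
    change σ (c • X) = -(c • X)
    rw [map_smul, hX, smul_neg]

theorem mem_skewPart {σ : A →ₗ[ℝ] A} {X : A} : X ∈ skewPart σ ↔ σ X = -X := Iff.rfl

/-- The `σ`-skew elements that anticommute with `h`. -/
def antiPart (σ : A →ₗ[ℝ] A) (h : A) : Submodule ℝ A where
  carrier := {X | σ X = -X ∧ X * h = -(h * X)}
  zero_mem' := by simp
  add_mem' := by
    rintro X Y ⟨hX, hX'⟩ ⟨hY, hY'⟩
    exact ⟨by rw [map_add, hX, hY, neg_add], by rw [add_mul, mul_add, hX', hY', neg_add]⟩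
  smul_mem' := by
    rintro c X ⟨hX, hX'⟩
    exact ⟨by rw [map_smul, hX, smul_neg], by rw [smul_mul_assoc, mul_smul_comm, hX', smul_neg]⟩

theorem mem_antiPart {σ : A →ₗ[ℝ] A} {h X : A} :
    X ∈ antiPart σ h ↔ σ X = -X ∧ X * h = -(h * X) := Iff.rfl

/-- The `σ`-unitary elements with square `s`. -/
def involutions (σ : A →ₗ[ℝ] A) (s : A) : Set A := {h | σ h * h = 1 ∧ h * h = s}

end Skew

/-! ### The adjoint of the Hermitian form and its eigenspace dimensions -/

section Adjoint

variable (n : ℕ)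

theorem formMatrix_mul_self : formMatrix n * formMatrix n = 1 := by
  ext1 i j
  rw [Matrix.mul_apply, Finset.sum_eq_single (Equiv.swap 0 (Fin.last n) i)]
  · simp [formMatrix, Matrix.one_apply]
  · intro k _ hk
    simp [formMatrix, hk.symm]
  · simp

theorem conjTranspose_formMatrix : (formMatrix n)ᴴ = formMatrix n := by
  ext1 i j
  have : Equiv.swap 0 (Fin.last n) j = i ↔ Equiv.swap 0 (Fin.last n) i = j := by
    constructor <;> (rintro rfl; simp)
  simp only [formMatrix, Matrix.conjTranspose_apply, this]
  split_ifs <;> simp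

/-- The adjoint with respect to the Hermitian form. -/
noncomputable def adj : Matrix (Fin (n + 1)) (Fin (n + 1)) ℍ[ℝ] →ₗ[ℝ]
    Matrix (Fin (n + 1)) (Fin (n + 1)) ℍ[ℝ] where
  toFun X := formMatrix n * Xᴴ * formMatrix n
  map_add' X Y := by simp [mul_add, add_mul]
  map_smul' c X := by
    have : (c • X)ᴴ = c • Xᴴ := by
      ext1 i j
      simp only [Matrix.conjTranspose_apply, Matrix.smul_apply]
      exact Quaternion.star_smul c (X j i)
    simp [this]

theorem adj_apply (X : Matrix (Fin (n + 1)) (Fin (n + 1)) ℍ[ℝ]) :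
    adj n X = formMatrix n * Xᴴ * formMatrix n := rfl

theorem adj_mul (X Y : Matrix (Fin (n + 1)) (Fin (n + 1)) ℍ[ℝ]) :
    adj n (X * Y) = adj n Y * adj n X := by
  simp only [adj_apply, Matrix.conjTranspose_mul]
  have : formMatrix n * Yᴴ * formMatrix n * (formMatrix n * Xᴴ * formMatrix n)
      = formMatrix n * Yᴴ * (formMatrix n * formMatrix n) * Xᴴ * formMatrix n := by
    simp only [mul_assoc]
  rw [this, formMatrix_mul_self]
  simp only [mul_assoc, one_mul]

theorem adj_adj (X : Matrix (Fin (n + 1)) (Fin (n + 1)) ℍ[ℝ]) : adj n (adj n X) = X := by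
  simp only [adj_apply, Matrix.conjTranspose_mul, Matrix.conjTranspose_conjTranspose,
    conjTranspose_formMatrix]
  have : formMatrix n * (formMatrix n * (X * formMatrix n)) * formMatrix n
      = formMatrix n * formMatrix n * X * (formMatrix n * formMatrix n) := by
    simp only [mul_assoc]
  rw [this, formMatrix_mul_self, one_mul, mul_one]

theorem trace_adj : LinearMap.trace ℝ _ (adj n) = -2 * (n + 1) := by
  rw [trace_mul_conjTranspose_mul _ _ _ (adj_apply n), conjTranspose_formMatrix,
    formMatrix_mul_self]
  simp

theorem re_trace_conjTranspose {ι : Type*} [Fintype ι] (X : Matrix ι ι ℍ[ℝ]) :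
    Xᴴ.trace.re = X.trace.re := by
  rw [Matrix.trace_conjTranspose, Quaternion.re_star]

/-- Over `ℍ` the trace itself is not cyclic; only its real part is. -/
theorem re_trace_mul_comm {ι : Type*} [Fintype ι] (X Y : Matrix ι ι ℍ[ℝ]) :
    (X * Y).trace.re = (Y * X).trace.re := by
  simp only [Matrix.trace, Matrix.diag, Matrix.mul_apply]
  change quaternionRe _ = quaternionRe _
  simp only [map_sum]
  rw [Finset.sum_comm]
  refine Finset.sum_congr rfl fun i _ => Finset.sum_congr rfl fun j _ => ?_
  change (X j i * Y i j).re = (Y i j * X j i).re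
  simp only [Quaternion.re_mul]
  ring

/-- The rank of the projection `(1 - σ)/2` is its trace. This is the dimension of the Lie algebra of
Sp(n,1). -/
theorem finrank_skewPart_adj :
    Module.finrank ℝ (skewPart (adj n)) = (n + 1) * (2 * (n + 1) + 1) := by
  have hP : LinearMap.IsProj (skewPart (adj n))
      ((2⁻¹ : ℝ) • (LinearMap.id - adj n)) := by
    constructor
    · intro X
      rw [mem_skewPart]
      simp only [LinearMap.smul_apply, LinearMap.sub_apply, LinearMap.id_apply, map_smul, map_sub,
        adj_adj]
      rw [← smul_neg, neg_sub]
    · intro X hX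
      rw [mem_skewPart] at hX
      simp only [LinearMap.smul_apply, LinearMap.sub_apply, LinearMap.id_apply, hX]
      rw [sub_neg_eq_add, ← two_smul ℝ X, smul_smul]
      norm_num
  have h := hP.trace
  rw [map_smul, map_sub, trace_adj, LinearMap.trace_id] at h
  have hf : Module.finrank ℝ (Matrix (Fin (n + 1)) (Fin (n + 1)) ℍ[ℝ])
      = (n + 1) * (n + 1) * 4 := by
    rw [Module.finrank_matrix, Quaternion.finrank_eq_four]; simp
  rw [hf] at h
  rw [← Nat.cast_inj (R := ℝ), ← h]
  push_cast
  rw [smul_eq_mul]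
  ring

/-- The space is the common `-1`-eigenspace of the commuting involutions `σ` and `Ad : X ↦ h X h⁻¹`,
so its dimension is the trace of `(1 - σ)(1 - Ad)/4`. Here `tr Ad = 4 (Re tr h)²` enters negatively
and is dropped, while `tr (Ad ∘ σ) = -2 Re tr h²` is at most `2(n+1)`. -/
theorem finrank_antiPart_adj_le (h : Matrix (Fin (n + 1)) (Fin (n + 1)) ℍ[ℝ])
    (hh : adj n h * h = 1) (h2 : h * h = 1 ∨ h * h = -1) :
    Module.finrank ℝ (antiPart (adj n) h) ≤ (n + 1) * (n + 2) := by
  have hh' : h * adj n h = 1 := by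
    rcases h2 with h2 | h2
    · have : adj n h = h := by
        rw [← mul_one (adj n h), ← h2, ← mul_assoc, hh, one_mul]
      rw [this, h2]
    · have : adj n h = -h := by
        rw [← mul_one (adj n h), ← neg_neg (1 : Matrix (Fin (n + 1)) (Fin (n + 1)) ℍ[ℝ]), ← h2,
          mul_neg, ← mul_assoc, hh, one_mul]
      rw [this, mul_neg, h2, neg_neg]
  set Ad : Matrix (Fin (n + 1)) (Fin (n + 1)) ℍ[ℝ] →ₗ[ℝ] Matrix (Fin (n + 1)) (Fin (n + 1)) ℍ[ℝ] :=
    LinearMap.mulLeftRight ℝ (h, adj n h) with hAd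
  have hAd_apply : ∀ X, Ad X = h * X * adj n h := fun X => LinearMap.mulLeftRight_apply _ _ _
  have hcomm : ∀ X, adj n (Ad X) = Ad (adj n X) := fun X => by
    rw [hAd_apply, hAd_apply, adj_mul, adj_mul, adj_adj, mul_assoc]
  have hAdAd : ∀ X, Ad (Ad X) = X := fun X => by
    have e : h * (h * X * adj n h) * adj n h = (h * h) * X * adj n (h * h) := by
      rw [adj_mul]; simp only [mul_assoc]
    rw [hAd_apply, hAd_apply, e]
    have a1 : adj n 1 = 1 := by simp [adj_apply, formMatrix_mul_self]
    rcases h2 with h2 | h2 <;> simp [h2, a1]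
  have hP : LinearMap.IsProj (antiPart (adj n) h)
      ((4⁻¹ : ℝ) • (LinearMap.id - adj n - Ad + Ad ∘ₗ adj n)) := by
    constructor
    · intro X
      rw [mem_antiPart]
      simp only [LinearMap.smul_apply, LinearMap.add_apply, LinearMap.sub_apply,
        LinearMap.id_apply, LinearMap.comp_apply]
      constructor
      · simp only [map_smul, map_sub, map_add, hcomm, adj_adj]
        rw [← smul_neg]; congr 1; abel
      · have key : Ad (X - adj n X - Ad X + Ad (adj n X)) = -(X - adj n X - Ad X + Ad (adj n X)) := by
          simp only [map_sub, map_add, hAdAd]; abel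
        generalize X - adj n X - Ad X + Ad (adj n X) = Y at key
        rw [hAd_apply] at key
        have : h * Y = -(Y * h) := by
          calc h * Y = h * Y * adj n h * h := by rw [mul_assoc _ _ h, hh, mul_one]
            _ = _ := by rw [key, neg_mul]
        rw [smul_mul_assoc, mul_smul_comm, this, smul_neg, neg_neg]
    · intro X hX
      obtain ⟨h3, h4⟩ := mem_antiPart.1 hX
      have hAX : Ad X = -X := by
        rw [hAd_apply, ← neg_neg (h * X), ← h4, neg_mul, mul_assoc, hh', mul_one]
      simp only [LinearMap.smul_apply, LinearMap.add_apply, LinearMap.sub_apply,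
        LinearMap.id_apply, LinearMap.comp_apply, h3, hAX, map_neg, neg_neg, sub_neg_eq_add]
      module
  have ht := hP.trace
  have t1 : LinearMap.trace ℝ _ Ad = 4 * (h.trace.re * h.trace.re) := by
    rw [trace_mul_mul _ _ _ hAd_apply, adj_apply, re_trace_mul_comm (formMatrix n * hᴴ), ← mul_assoc (formMatrix n),
      formMatrix_mul_self, one_mul, re_trace_conjTranspose]
  have t2 : LinearMap.trace ℝ _ (Ad ∘ₗ adj n) = -2 * (h * h).trace.re := by
    rw [trace_mul_conjTranspose_mul _ (h * formMatrix n) (formMatrix n * adj n h)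
      (fun X => by
        rw [LinearMap.comp_apply, hAd_apply, adj_apply n X]; simp only [mul_assoc])]
    rw [adj_apply, Matrix.conjTranspose_mul, conjTranspose_formMatrix]
    have e : formMatrix n * hᴴ * (formMatrix n * (formMatrix n * hᴴ * formMatrix n))
        = formMatrix n * (hᴴ * (formMatrix n * formMatrix n) * hᴴ * formMatrix n) := by
      simp only [mul_assoc]
    rw [e, re_trace_mul_comm, mul_assoc, formMatrix_mul_self, mul_one, mul_one,
      ← Matrix.conjTranspose_mul, re_trace_conjTranspose]
  have t3 : -((n : ℝ) + 1) ≤ (h * h).trace.re := by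
    rcases h2 with h2 | h2
    · rw [h2]; simp; linarith [Nat.cast_nonneg (α := ℝ) n]
    · rw [h2]; simp
  have hf : Module.finrank ℝ (Matrix (Fin (n + 1)) (Fin (n + 1)) ℍ[ℝ])
      = (n + 1) * (n + 1) * 4 := by
    rw [Module.finrank_matrix, Quaternion.finrank_eq_four]; simp
  rw [map_smul, map_add, map_sub, map_sub, trace_adj, LinearMap.trace_id, t1, t2, hf,
    smul_eq_mul] at ht
  rw [← Nat.cast_le (α := ℝ), ← ht]
  push_cast
  nlinarith [mul_self_nonneg h.trace.re]

end Adjoint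

/-! ### Cayley charts and the dimension of sets of involutions -/

section Involutions

variable {A : Type*} [NormedRing A] [NormedAlgebra ℝ A]

/-- The Cayley transform based at `h`. -/
noncomputable def cayley (h X : A) : A := (1 + X) * Ring.inverse (1 - X) * h

/-- Two elements of `involutions σ s` with invertible sum are related by the Cayley transform of a
skew element that anticommutes with the first one. -/
theorem exists_cayley_eq {σ : A →ₗ[ℝ] A} (hσ : ∀ x y, σ (x * y) = σ y * σ x) (hσ1 : σ 1 = 1)
    {s : A} (hs : s = 1 ∨ s = -1) {h₀ h : A} (h₀s : h₀ ∈ involutions σ s)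
    (hhs : h ∈ involutions σ s) (hu : IsUnit (h + h₀)) :
    ∃ X ∈ antiPart σ h₀, IsUnit (1 - X) ∧ cayley h₀ X = h := by
  obtain ⟨u, hu⟩ := hu
  obtain ⟨a1, a2⟩ := h₀s
  obtain ⟨b1, b2⟩ := hhs
  -- Unitarity and `g² = s = ±1` make `g` self-adjoint up to the sign `s`.
  have key : ∀ g : A, σ g * g = 1 → g * g = s → σ g = s * g := by
    intro g g1 g2
    have e : σ g * s = g := by rw [← g2, ← mul_assoc, g1, one_mul]
    rcases hs with rfl | rfl
    · rw [one_mul]; rwa [mul_one] at e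
    · rw [mul_neg, mul_one] at e
      rw [neg_mul, one_mul, ← e, neg_neg, e]
  have sA : σ (u : A) = s * u := by rw [hu, map_add, key _ a1 a2, key _ b1 b2, mul_add]
  have sB : σ (h - h₀) = s * (h - h₀) := by rw [map_sub, key _ a1 a2, key _ b1 b2, mul_sub]
  have ss : s * s = 1 := by rcases hs with rfl | rfl <;> simp
  have sc : ∀ x : A, x * s = s * x := by rcases hs with rfl | rfl <;> simp
  have sAi : σ (↑u⁻¹ : A) = s * ↑u⁻¹ := by
    have e : σ (↑u⁻¹ : A) * (s * u) = 1 := by rw [← sA, ← hσ, Units.mul_inv, hσ1]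
    calc σ (↑u⁻¹ : A) = σ (↑u⁻¹ : A) * ((s * s) * (u * ↑u⁻¹)) := by simp [ss]
      _ = σ (↑u⁻¹ : A) * (s * u) * (s * ↑u⁻¹) := by
        rw [mul_assoc (σ _), mul_assoc s (u : A), ← mul_assoc (u : A) s, sc (u : A)]
        simp only [mul_assoc]
      _ = _ := by rw [e, one_mul]
  have c1 : (u : A) * (h - h₀) = -((h - h₀) * u) := by
    rw [hu]; simp only [mul_sub, add_mul, sub_mul, mul_add, a2, b2]; abel
  have c2 : (h - h₀) * (↑u⁻¹ : A) = -(↑u⁻¹ * (h - h₀)) := by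
    rw [Units.mul_inv_eq_iff_eq_mul, neg_mul, mul_assoc, ← neg_eq_iff_eq_neg.2 c1, mul_neg,
      neg_neg, ← mul_assoc, Units.inv_mul, one_mul]
  have c3 : (↑u⁻¹ : A) * h₀ = h * ↑u⁻¹ := by
    rw [Units.eq_mul_inv_iff_mul_eq, mul_assoc, Units.inv_mul_eq_iff_eq_mul, hu, mul_add, add_mul,
      a2, b2, add_comm]
  have c4 : (h - h₀) * h = -(h₀ * (h - h₀)) := by
    rw [sub_mul, mul_sub, a2, b2]; abel
  have e1 : 1 - (h - h₀) * (↑u⁻¹ : A) = (2 : ℝ) • (h₀ * ↑u⁻¹) := by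
    have : (1 : A) = (h + h₀) * ↑u⁻¹ := by rw [← hu, Units.mul_inv]
    rw [this, ← sub_mul, ← smul_mul_assoc]
    congr 1
    module
  have e2 : 1 + (h - h₀) * (↑u⁻¹ : A) = (2 : ℝ) • (h * ↑u⁻¹) := by
    have : (1 : A) = (h + h₀) * ↑u⁻¹ := by rw [← hu, Units.mul_inv]
    rw [this, ← add_mul, ← smul_mul_assoc]
    congr 1
    module
  let v : Aˣ :=
    { val := h₀
      inv := s * h₀
      val_inv := by rw [← mul_assoc, sc, mul_assoc, a2, ss]
      inv_val := by rw [mul_assoc, a2, ss] }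
  let w : Aˣ :=
    { val := (2 : ℝ) • (h₀ * ↑u⁻¹)
      inv := (2⁻¹ : ℝ) • (u * ↑v⁻¹)
      val_inv := by
        change (2 : ℝ) • ((v : A) * ↑u⁻¹) * (2⁻¹ : ℝ) • (u * ↑v⁻¹ : A) = 1
        simp [smul_smul, mul_assoc]
      inv_val := by
        change (2⁻¹ : ℝ) • (u * ↑v⁻¹ : A) * (2 : ℝ) • ((v : A) * ↑u⁻¹) = 1
        simp [smul_smul, mul_assoc] }
  -- Solving `(1 + X)(1 - X)⁻¹ h₀ = h` for `X` gives `(h - h₀)(h + h₀)⁻¹`. Skewness and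
  -- anticommutation follow from `h² = h₀²`, by which `h + h₀` and `h - h₀` anticommute.
  refine ⟨(h - h₀) * ↑u⁻¹, ⟨?_, ?_⟩, ⟨w, e1.symm⟩, ?_⟩
  · rw [hσ, sAi, sB, c2, neg_neg, ← mul_assoc, mul_assoc s, sc, ← mul_assoc, ss, one_mul]
  · rw [mul_assoc, c3, ← mul_assoc, c4, neg_mul, mul_assoc]
  · rw [cayley, e1, e2]
    change _ * Ring.inverse (w : A) * _ = _
    rw [Ring.inverse_unit]
    change (2 : ℝ) • (h * ↑u⁻¹) * (2⁻¹ : ℝ) • (u * ↑v⁻¹ : A) * (v : A) = h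
    simp [smul_smul, mul_assoc]

variable [FiniteDimensional ℝ A]

theorem contDiffAt_cayley (h X : A) (hX : IsUnit (1 - X)) : ContDiffAt ℝ 1 (cayley h) X := by
  have : CompleteSpace A := FiniteDimensional.complete ℝ A
  obtain ⟨u, hu⟩ := hX
  have h1 : ContDiffAt ℝ 1 (fun X : A => Ring.inverse (1 - X)) X := by
    have h2 : ContDiffAt ℝ 1 Ring.inverse (1 - X) := hu ▸ contDiffAt_ringInverse ℝ u
    exact h2.comp X (contDiffAt_const.sub contDiffAt_id)
  exact ((contDiffAt_const.add contDiffAt_id).mul h1).mul contDiffAt_const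

/-- Locally, triples of involutions are parametrized by triples of anticommuting skew elements. -/
theorem dimH_involutions_prod_le {σ : A →ₗ[ℝ] A} (hσ : ∀ x y, σ (x * y) = σ y * σ x)
    (hσ1 : σ 1 = 1) {a : ℕ} {s₀ s₁ s₂ : A} (hs₀ : s₀ = 1 ∨ s₀ = -1) (hs₁ : s₁ = 1 ∨ s₁ = -1)
    (hs₂ : s₂ = 1 ∨ s₂ = -1)
    (ha : ∀ s h, (s = 1 ∨ s = -1) → h ∈ involutions σ s → Module.finrank ℝ (antiPart σ h) ≤ a) :
    dimH (involutions σ s₀ ×ˢ involutions σ s₁ ×ˢ involutions σ s₂) ≤ (3 * a : ℕ) := by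
  have : CompleteSpace A := FiniteDimensional.complete ℝ A
  have : ProperSpace A := FiniteDimensional.proper ℝ A
  by_contra! hlt
  -- Hausdorff dimension is local: a set exceeding the bound has a point all of whose relative
  -- neighbourhoods exceed it.
  obtain ⟨⟨h₀, h₁, h₂⟩, ⟨m₀, m₁, m₂⟩, hx⟩ := exists_mem_nhdsWithin_lt_dimH_of_lt_dimH hlt
  simp only at m₀ m₁ m₂
  -- At the base point the sum is `2h`, invertible as `h² = ±1`; hence the Cayley chart covers a
  -- neighbourhood.
  have hunit : ∀ s h : A, (s = 1 ∨ s = -1) → h ∈ involutions σ s → IsUnit (h + h) := by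
    rintro s h hs ⟨-, h2⟩
    rw [← two_smul ℝ h, ← Units.smul_mk0 (two_ne_zero' ℝ), isUnit_smul_iff]
    have : IsUnit (h * h) := by
      rcases hs with rfl | rfl <;> rw [h2]
      exacts [isUnit_one, isUnit_one.neg]
    exact ((Commute.refl h).isUnit_mul_iff.1 this).1
  have hnhds : ∀ s h : A, (s = 1 ∨ s = -1) → h ∈ involutions σ s →
      {g : A | IsUnit (g + h)} ∈ nhds h := fun s h hs hh =>
    (continuous_id.add continuous_const).continuousAt.preimage_mem_nhds
      (Units.isOpen.mem_nhds (hunit s h hs hh))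
  have ht := inter_mem_nhdsWithin (involutions σ s₀ ×ˢ involutions σ s₁ ×ˢ involutions σ s₂)
    (prod_mem_nhds (hnhds s₀ h₀ hs₀ m₀) (prod_mem_nhds (hnhds s₁ h₁ hs₁ m₁) (hnhds s₂ h₂ hs₂ m₂)))
  have hlt2 := hx _ ht
  -- The three charts are used jointly because Hausdorff dimension is not subadditive under
  -- products.
  let F : antiPart σ h₀ × antiPart σ h₁ × antiPart σ h₂ → A × A × A :=
    fun p => (cayley h₀ p.1, cayley h₁ p.2.1, cayley h₂ p.2.2)
  let D : Set (antiPart σ h₀ × antiPart σ h₁ × antiPart σ h₂) :=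
    {p | IsUnit (1 - p.1 : A) ∧ IsUnit (1 - p.2.1 : A) ∧ IsUnit (1 - p.2.2 : A)}
  have hsub : (involutions σ s₀ ×ˢ involutions σ s₁ ×ˢ involutions σ s₂) ∩
      ({g : A | IsUnit (g + h₀)} ×ˢ {g : A | IsUnit (g + h₁)} ×ˢ {g : A | IsUnit (g + h₂)})
      ⊆ F '' D := by
    rintro ⟨g₀, g₁, g₂⟩ ⟨⟨i₀, i₁, i₂⟩, u₀, u₁, u₂⟩
    obtain ⟨X₀, x₀, v₀, e₀⟩ := exists_cayley_eq hσ hσ1 hs₀ m₀ i₀ u₀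
    obtain ⟨X₁, x₁, v₁, e₁⟩ := exists_cayley_eq hσ hσ1 hs₁ m₁ i₁ u₁
    obtain ⟨X₂, x₂, v₂, e₂⟩ := exists_cayley_eq hσ hσ1 hs₂ m₂ i₂ u₂
    exact ⟨(⟨X₀, x₀⟩, ⟨X₁, x₁⟩, ⟨X₂, x₂⟩), ⟨v₀, v₁, v₂⟩, by simp only [F, e₀, e₁, e₂]⟩
  have hF : ∀ p ∈ D, ContDiffAt ℝ 1 F p := by
    rintro p ⟨d₀, d₁, d₂⟩
    have q : ∀ (h : A), ContDiff ℝ 1 (fun X : antiPart σ h => (X : A)) := fun h =>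
      (antiPart σ h).subtypeL.contDiff
    refine ContDiffAt.prodMk ?_ (ContDiffAt.prodMk ?_ ?_)
    · exact (contDiffAt_cayley h₀ _ d₀).comp p ((q h₀).comp contDiff_fst).contDiffAt
    · exact (contDiffAt_cayley h₁ _ d₁).comp p
        ((q h₁).comp (contDiff_fst.comp contDiff_snd)).contDiffAt
    · exact (contDiffAt_cayley h₂ _ d₂).comp p
        ((q h₂).comp (contDiff_snd.comp contDiff_snd)).contDiffAt
  have hle : dimH (F '' D) ≤ dimH D := by
    refine dimH_image_le_of_locally_lipschitzOn fun p hp => ?_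
    obtain ⟨K, t, ht, hK⟩ := (hF p hp).exists_lipschitzOnWith
    exact ⟨K, t, mem_nhdsWithin_of_mem_nhds ht, hK⟩
  have hfin : dimH D ≤ (3 * a : ℕ) := by
    refine (dimH_mono (Set.subset_univ D)).trans ?_
    rw [Real.dimH_univ_eq_finrank, Module.finrank_prod, Module.finrank_prod]
    have := ha s₀ h₀ hs₀ m₀
    have := ha s₁ h₁ hs₁ m₁
    have := ha s₂ h₂ hs₂ m₂
    exact_mod_cast (by omega)
  exact absurd (hlt2.trans_le ((dimH_mono hsub).trans (hle.trans hfin))) (lt_irrefl _)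

/-- The pairs obtained from triples of involutions by multiplication have small dimension. -/
theorem dimH_image_involutions_le {σ : A →ₗ[ℝ] A} (hσ : ∀ x y, σ (x * y) = σ y * σ x)
    (hσ1 : σ 1 = 1) {a : ℕ}
    (ha : ∀ s h, (s = 1 ∨ s = -1) → h ∈ involutions σ s → Module.finrank ℝ (antiPart σ h) ≤ a) :
    dimH {p : A × A | ∃ s₀ s₁ s₂ h k₁ k₂ : A, (s₀ = 1 ∨ s₀ = -1) ∧ (s₁ = 1 ∨ s₁ = -1) ∧
      (s₂ = 1 ∨ s₂ = -1) ∧ h ∈ involutions σ s₀ ∧ k₁ ∈ involutions σ s₁ ∧ k₂ ∈ involutions σ s₂ ∧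
      p = (s₀ * h * k₁, s₀ * h * k₂)} ≤ (3 * a : ℕ) := by
  have : ProperSpace A := FiniteDimensional.proper ℝ A
  let S : Set A := {1, -1}
  have hS : S.Countable := (Set.toFinite S).countable
  -- Only eight sign choices occur, and a countable union does not raise the dimension.
  have hsub : {p : A × A | ∃ s₀ s₁ s₂ h k₁ k₂ : A, (s₀ = 1 ∨ s₀ = -1) ∧ (s₁ = 1 ∨ s₁ = -1) ∧
      (s₂ = 1 ∨ s₂ = -1) ∧ h ∈ involutions σ s₀ ∧ k₁ ∈ involutions σ s₁ ∧ k₂ ∈ involutions σ s₂ ∧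
      p = (s₀ * h * k₁, s₀ * h * k₂)} ⊆ ⋃ s ∈ S ×ˢ S ×ˢ S,
        (fun q : A × A × A => (s.1 * q.1 * q.2.1, s.1 * q.1 * q.2.2)) ''
          (involutions σ s.1 ×ˢ involutions σ s.2.1 ×ˢ involutions σ s.2.2) := by
    rintro p ⟨s₀, s₁, s₂, h, k₁, k₂, hs₀, hs₁, hs₂, hh, hk₁, hk₂, rfl⟩
    exact Set.mem_biUnion (x := (s₀, s₁, s₂)) ⟨hs₀, hs₁, hs₂⟩ ⟨(h, k₁, k₂), ⟨hh, hk₁, hk₂⟩, rfl⟩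
  refine (dimH_mono hsub).trans ?_
  rw [dimH_bUnion (hS.prod (hS.prod hS))]
  refine iSup₂_le fun s hs => ?_
  obtain ⟨hs₀, hs₁, hs₂⟩ := hs
  refine le_trans ?_ (dimH_involutions_prod_le hσ hσ1 hs₀ hs₁ hs₂ ha)
  refine dimH_image_le_of_locally_lipschitzOn fun q _ => ?_
  have hc : ContDiff ℝ 1 (fun q : A × A × A => (s.1 * q.1 * q.2.1, s.1 * q.1 * q.2.2)) := by
    fun_prop
  obtain ⟨K, t, ht, hK⟩ := (hc.contDiffAt (x := q)).exists_lipschitzOnWith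
  exact ⟨K, t, mem_nhdsWithin_of_mem_nhds ht, hK⟩

end Involutions

/-! ### The exponential and small sets -/

section Exp

variable {A : Type*} [NormedRing A] [NormedAlgebra ℝ A]

/-- The exponential as a unit. -/
noncomputable def expUnit [CompleteSpace A] (X : A) : Aˣ :=
  letI := NormedAlgebra.restrictScalars ℚ ℝ A
  { val := NormedSpace.exp X
    inv := NormedSpace.exp (-X)
    val_inv := by
      rw [← NormedSpace.exp_add_of_commute (Commute.refl X).neg_right, add_neg_cancel,
        NormedSpace.exp_zero]
    inv_val := by
      rw [← NormedSpace.exp_add_of_commute (Commute.refl X).neg_left, neg_add_cancel,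
        NormedSpace.exp_zero] }

theorem continuous_expUnit [CompleteSpace A] : Continuous (expUnit : A → Aˣ) := by
  let := NormedAlgebra.restrictScalars ℚ ℝ A
  exact Units.continuous_iff.2 ⟨NormedSpace.exp_continuous,
    NormedSpace.exp_continuous.comp continuous_neg⟩

variable [FiniteDimensional ℝ A]

/-- The strict derivative of `exp` at `0` is the identity, so near `0` the error is at most half of
`‖X - Y‖`. -/
theorem exists_norm_sub_le_two_mul_norm_exp_sub :
    ∃ r : ℝ, 0 < r ∧ ∀ X Y : A, ‖X‖ < r → ‖Y‖ < r →
      ‖X - Y‖ ≤ 2 * ‖NormedSpace.exp X - NormedSpace.exp Y‖ := by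
  have : CompleteSpace A := FiniteDimensional.complete ℝ A
  have h := hasStrictFDerivAt_exp_zero (𝕂 := ℝ) (𝔸 := A)
  obtain ⟨s, hs, hc⟩ := h.approximates_deriv_on_nhds (c := 1 / 2) (Or.inr (by norm_num))
  obtain ⟨r, hr, hrs⟩ := Metric.mem_nhds_iff.1 hs
  refine ⟨r, hr, fun X Y hX hY => ?_⟩
  have h1 : ‖NormedSpace.exp X - NormedSpace.exp Y - (X - Y)‖ ≤ 1 / 2 * ‖X - Y‖ := by
    simpa using hc X (hrs (by simpa using hX)) Y (hrs (by simpa using hY))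
  have h2 := norm_sub_norm_le (X - Y) (NormedSpace.exp X - NormedSpace.exp Y)
  rw [norm_sub_rev (X - Y)] at h2
  linarith

/-- Applying `σ` termwise to the series gives `σ (exp X) = exp (-X)`. -/
theorem map_expUnit_mul_expUnit [CompleteSpace A] {σ : A →ₗ[ℝ] A}
    (hσ : ∀ x y, σ (x * y) = σ y * σ x) (hσ1 : σ 1 = 1) {X : A} (hX : σ X = -X) :
    σ (expUnit X : A) * (expUnit X : A) = 1 := by
  have hpow : ∀ k : ℕ, σ (X ^ k) = (-X) ^ k := by
    intro k
    induction k with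
    | zero => simp [hσ1]
    | succ k ih => rw [pow_succ, hσ, ih, hX, ← pow_succ']
  have h1 := (NormedSpace.exp_series_hasSum_exp' (𝕂 := ℝ) X).mapL σ.toContinuousLinearMap
  simp only [LinearMap.coe_toContinuousLinearMap', map_smul, hpow] at h1
  have h2 : σ (expUnit X : A) = (↑(expUnit X)⁻¹ : A) :=
    h1.unique (NormedSpace.exp_series_hasSum_exp' (𝕂 := ℝ) (-X))
  rw [h2, Units.inv_mul]

/-- Translates of a set of small dimension pull back to null sets under the exponential. -/
theorem exists_hausdorffMeasure_exp_preimage_eq_zero [CompleteSpace A] (V : Submodule ℝ A)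
    [MeasurableSpace (V × V)] [BorelSpace (V × V)] {E : Set (A × A)}
    (hE : dimH E < (Module.finrank ℝ (V × V) : ℕ)) :
    ∃ r : ℝ, 0 < r ∧ ∀ a b : Aˣ, μH[(Module.finrank ℝ (V × V) : ℕ)]
      {p : V × V | p ∈ Metric.ball 0 r ∧
        ((a : A) * expUnit (p.1 : A), (b : A) * expUnit (p.2 : A)) ∈ E} = 0 := by
  obtain ⟨r, hr, hexp⟩ := exists_norm_sub_le_two_mul_norm_exp_sub (A := A)
  refine ⟨r, hr, fun a b => ?_⟩
  let f : Metric.ball (0 : V × V) r → A × A := fun p =>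
    ((a : A) * NormedSpace.exp (p.1.1 : A), (b : A) * NormedSpace.exp (p.1.2 : A))
  -- Translation by `c` changes the antilipschitz constant but not `r`, so one ball serves all
  -- translates.
  have key : ∀ (c : Aˣ) (X Y : A), ‖X‖ < r → ‖Y‖ < r → dist X Y ≤ 2 * ‖(↑c⁻¹ : A)‖ *
      dist ((c : A) * NormedSpace.exp X) ((c : A) * NormedSpace.exp Y) := by
    intro c X Y hX hY
    rw [dist_eq_norm, dist_eq_norm, ← mul_sub, mul_assoc]
    refine (hexp X Y hX hY).trans (mul_le_mul_of_nonneg_left ?_ zero_le_two)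
    calc ‖NormedSpace.exp X - NormedSpace.exp Y‖
        = ‖(↑c⁻¹ : A) * (c * (NormedSpace.exp X - NormedSpace.exp Y))‖ := by
          rw [← mul_assoc, Units.inv_mul, one_mul]
      _ ≤ _ := norm_mul_le _ _
  have hf : AntilipschitzWith (2 * (‖(↑a⁻¹ : A)‖₊ + ‖(↑b⁻¹ : A)‖₊)) f := by
    refine AntilipschitzWith.of_le_mul_dist fun p q => ?_
    have hp := p.2
    have hq := q.2
    rw [mem_ball_zero_iff, Prod.norm_def, max_lt_iff] at hp hq
    have h1 := key a _ _ hp.1 hq.1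
    have h2 := key b _ _ hp.2 hq.2
    have h3 : dist (f p).1 (f q).1 ≤ dist (f p) (f q) := le_max_left _ _
    have h4 : dist (f p).2 (f q).2 ≤ dist (f p) (f q) := le_max_right _ _
    rw [Subtype.dist_eq, Prod.dist_eq]
    push_cast
    refine max_le ?_ ?_
    · refine h1.trans (mul_le_mul ?_ h3 dist_nonneg (by positivity))
      simp
    · refine h2.trans (mul_le_mul ?_ h4 dist_nonneg (by positivity))
      simp
  have hS : {p : V × V | p ∈ Metric.ball 0 r ∧
      ((a : A) * expUnit (p.1 : A), (b : A) * expUnit (p.2 : A)) ∈ E}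
      = Subtype.val '' (f ⁻¹' E) := by
    ext p
    constructor
    · rintro ⟨h1, h2⟩
      exact ⟨⟨p, h1⟩, h2, rfl⟩
    · rintro ⟨q, hq, rfl⟩
      exact ⟨q.2, hq⟩
  have hdim : dimH (Subtype.val '' (f ⁻¹' E)) < (Module.finrank ℝ (V × V) : ℕ) := by
    rw [isometry_subtype_coe.dimH_image]
    exact (hf.dimH_preimage_le E).trans_lt hE
  rw [hS]
  have := hausdorffMeasure_of_dimH_lt (d := (Module.finrank ℝ (V × V) : ℕ)) (by exact_mod_cast hdim)
  exact_mod_cast this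

/-- A nonzero finite measure on `V × V` for which every translate of a given set of small
dimension pulls back to a null set under the exponential. -/
theorem exists_measure_exp_preimage_null_of_dimH_lt [CompleteSpace A] (V : Submodule ℝ A)
    {E : Set (A × A)} (hE : dimH E < (Module.finrank ℝ (V × V) : ℕ)) :
    letI := borel (V × V)
    ∃ ν : Measure (V × V), IsFiniteMeasure ν ∧ ν ≠ 0 ∧ ∀ a b : Aˣ,
      ν {p : V × V | ((a : A) * expUnit (p.1 : A), (b : A) * expUnit (p.2 : A)) ∈ E} = 0 := by
  let : MeasurableSpace (V × V) := borel _
  have : BorelSpace (V × V) := ⟨rfl⟩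
  obtain ⟨r, hr, hnull⟩ := exists_hausdorffMeasure_exp_preimage_eq_zero V hE
  have : ProperSpace (V × V) := FiniteDimensional.proper ℝ _
  -- In top dimension, Hausdorff measure is positive and finite on balls.
  refine ⟨(μH[(Module.finrank ℝ (V × V) : ℕ)]).restrict (Metric.ball 0 r), ⟨?_⟩, ?_, fun a b => ?_⟩
  · rw [Measure.restrict_apply_univ]
    exact measure_ball_lt_top
  · rw [Ne, Measure.restrict_eq_zero]
    exact (Metric.measure_ball_pos _ _ hr).ne'
  · rw [Measure.restrict_apply' measurableSet_ball]
    refine measure_mono_null ?_ (hnull a b)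
    rintro p ⟨hp, hpb⟩
    exact ⟨hpb, hp⟩

end Exp

/-! ### Haar null sets and measurability -/

section Group

variable {G : Type*} [Group G] [TopologicalSpace G] [IsTopologicalGroup G]

/-- A measurable set all of whose left translates pull back to null sets under some map from a
nonzero σ-finite measure space is Haar null. -/
theorem haar_eq_zero_of_translates_null [MeasurableSpace G] [BorelSpace G]
    [SecondCountableTopology G] (μ : Measure G) [SigmaFinite μ] [μ.IsMulLeftInvariant]
    {Ω : Type*} [MeasurableSpace Ω] (ν : Measure Ω) [SFinite ν] (hν : ν ≠ 0)
    {Φ : Ω → G} (hΦ : Measurable Φ) {E : Set G} (hE : MeasurableSet E)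
    (h : ∀ x, ν {ω | x * Φ ω ∈ E} = 0) : μ E = 0 := by
  let S : Set (G × Ω) := {p | p.1 * Φ p.2 ∈ E}
  have hS : MeasurableSet S := (measurable_fst.mul (hΦ.comp measurable_snd)) hE
  have h0 : (μ.prod ν) S = 0 := by
    rw [Measure.measure_prod_null hS]
    exact Filter.Eventually.of_forall h
  have h1 := Measure.measure_ae_null_of_prod_null (Measure.measurePreserving_swap
    (μ := ν) (ν := μ) |>.measure_preimage hS.nullMeasurableSet |>.trans h0)
  have : NeZero ν := ⟨hν⟩
  obtain ⟨ω, hω⟩ := h1.exists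
  -- Right translation preserves null sets of a left-invariant measure, even without unimodularity.
  exact (measure_mul_right_null μ (Φ ω)).1 hω

/-- The strongly doubly reversible pairs form a σ-compact set. -/
theorem measurableSet_stronglyDoublyReversible [T2Space G] [SigmaCompactSpace G]
    [MeasurableSpace (G × G)] [BorelSpace (G × G)] :
    MeasurableSet {p : G × G | StronglyDoublyReversible p.1 p.2} := by
  -- The projection of a closed set need not be closed, but closed subsets of a σ-compact space are
  -- σ-compact, and so are their images.
  have hc : IsClosed {q : G × G × G | q.1 ^ 2 = 1 ∧ q.1 * q.2.1 * q.1⁻¹ = q.2.1⁻¹ ∧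
      q.1 * q.2.2 * q.1⁻¹ = q.2.2⁻¹} :=
    (isClosed_eq (by fun_prop) (by fun_prop)).inter
      ((isClosed_eq (by fun_prop) (by fun_prop)).inter (isClosed_eq (by fun_prop) (by fun_prop)))
  have hi : {p : G × G | StronglyDoublyReversible p.1 p.2} = Prod.snd ''
      {q : G × G × G | q.1 ^ 2 = 1 ∧ q.1 * q.2.1 * q.1⁻¹ = q.2.1⁻¹ ∧
      q.1 * q.2.2 * q.1⁻¹ = q.2.2⁻¹} := by
    ext p
    constructor
    · rintro ⟨h, hh⟩
      exact ⟨(h, p), hh, rfl⟩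
    · rintro ⟨⟨h, p⟩, hh, rfl⟩
      exact ⟨h, hh⟩
  obtain ⟨K, hK, hKU⟩ := (isSigmaCompact_univ.of_isClosed_subset hc (Set.subset_univ _)).image
    (continuous_snd (X := G) (Y := G × G))
  rw [hi, ← hKU]
  exact MeasurableSet.iUnion fun i => (hK i).measurableSet

end Group

/-! ### Topology of Sp(n,1) and the dimension comparison -/

section Main

variable (n : ℕ)

/-- Units are open in a Banach algebra; the norm is chosen locally and induces the entrywise
topology. -/
theorem isOpenEmbedding_units_val :
    Topology.IsOpenEmbedding (Units.val : (Matrix (Fin (n + 1)) (Fin (n + 1)) ℍ[ℝ])ˣ → _) := by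
  let : NormedRing (Matrix (Fin (n + 1)) (Fin (n + 1)) ℍ[ℝ]) := Matrix.linftyOpNormedRing
  let : NormedAlgebra ℝ (Matrix (Fin (n + 1)) (Fin (n + 1)) ℍ[ℝ]) := Matrix.linftyOpNormedAlgebra
  have : CompleteSpace (Matrix (Fin (n + 1)) (Fin (n + 1)) ℍ[ℝ]) := FiniteDimensional.complete ℝ _
  exact Units.isOpenEmbedding_val

theorem mem_Sp_iff_adj (A : (Matrix (Fin (n + 1)) (Fin (n + 1)) ℍ[ℝ])ˣ) :
    A ∈ Sp n ↔ adj n A.val * A.val = 1 := by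
  rw [mem_Sp_iff, adj_apply]
  constructor
  · intro h
    rw [mul_assoc (formMatrix n), mul_assoc (formMatrix n), h, formMatrix_mul_self]
  · intro h
    calc _ = (formMatrix n * formMatrix n) * A.valᴴ * formMatrix n * A.val := by
          rw [formMatrix_mul_self, one_mul]
      _ = formMatrix n * (formMatrix n * A.valᴴ * formMatrix n * A.val) := by
          simp only [mul_assoc]
      _ = _ := by rw [h, mul_one]

theorem adj_one : adj n 1 = 1 := by simp [adj_apply, formMatrix_mul_self]

theorem isClosed_Sp : IsClosed (Sp n : Set (Matrix (Fin (n + 1)) (Fin (n + 1)) ℍ[ℝ])ˣ) := by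
  have : (Sp n : Set (Matrix (Fin (n + 1)) (Fin (n + 1)) ℍ[ℝ])ˣ)
      = {A | adj n A.val * A.val = 1} := by
    ext A; exact mem_Sp_iff_adj n A
  rw [this]
  have h1 : Continuous (adj n) := (adj n).continuous_of_finiteDimensional
  exact isClosed_eq ((h1.comp Units.continuous_val).mul Units.continuous_val) continuous_const

instance : SecondCountableTopology (Sp n) := by
  have : ProperSpace ℍ[ℝ] := FiniteDimensional.proper ℝ _
  have : SecondCountableTopology (Matrix (Fin (n + 1)) (Fin (n + 1)) ℍ[ℝ]) :=
    inferInstanceAs (SecondCountableTopology (Fin (n + 1) → Fin (n + 1) → ℍ[ℝ]))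
  have : SecondCountableTopology (Matrix (Fin (n + 1)) (Fin (n + 1)) ℍ[ℝ])ˣ :=
    (isOpenEmbedding_units_val n).isEmbedding.secondCountableTopology
  exact Topology.IsEmbedding.subtypeVal.secondCountableTopology

instance : LocallyCompactSpace (Sp n) := by
  have : ProperSpace ℍ[ℝ] := FiniteDimensional.proper ℝ _
  have : LocallyCompactSpace (Matrix (Fin (n + 1)) (Fin (n + 1)) ℍ[ℝ]) :=
    inferInstanceAs (LocallyCompactSpace (Fin (n + 1) → Fin (n + 1) → ℍ[ℝ]))
  have : LocallyCompactSpace (Matrix (Fin (n + 1)) (Fin (n + 1)) ℍ[ℝ])ˣ :=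
    (isOpenEmbedding_units_val n).locallyCompactSpace
  exact (isClosed_Sp n).isClosedEmbedding_subtypeVal.locallyCompactSpace

instance : T2Space (Sp n) := by
  have : T2Space (Matrix (Fin (n + 1)) (Fin (n + 1)) ℍ[ℝ])ˣ :=
    (isOpenEmbedding_units_val n).isEmbedding.t2Space
  infer_instance

instance : T2Space (PSp n) := by
  have : IsClosed (pmOne n : Set (Sp n)) := by
    have : (pmOne n : Set (Sp n)) = {1, ⟨-1, neg_one_mem_Sp n⟩} := rfl
    rw [this]
    exact (Set.toFinite _).isClosed
  infer_instance

/-- The exponential of a skew element, as an element of the group. -/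
noncomputable def expSp (X : skewPart (adj n)) : Sp n :=
  letI : NormedRing (Matrix (Fin (n + 1)) (Fin (n + 1)) ℍ[ℝ]) := Matrix.linftyOpNormedRing
  letI : NormedAlgebra ℝ (Matrix (Fin (n + 1)) (Fin (n + 1)) ℍ[ℝ]) := Matrix.linftyOpNormedAlgebra
  ⟨expUnit (X : Matrix (Fin (n + 1)) (Fin (n + 1)) ℍ[ℝ]),
    (mem_Sp_iff_adj n _).2 (map_expUnit_mul_expUnit (adj_mul n) (adj_one n) X.2)⟩

theorem continuous_expSp : Continuous (expSp n) := by
  let : NormedRing (Matrix (Fin (n + 1)) (Fin (n + 1)) ℍ[ℝ]) := Matrix.linftyOpNormedRing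
  let : NormedAlgebra ℝ (Matrix (Fin (n + 1)) (Fin (n + 1)) ℍ[ℝ]) := Matrix.linftyOpNormedAlgebra
  exact Continuous.subtype_mk (continuous_expUnit.comp continuous_subtype_val) _

variable {n} in
/-- A lift of an element of `PSp(n,1)` with trivial square is an involution up to sign. -/
theorem exists_mem_involutions {H : Sp n} (hH : (H : PSp n) * H = 1) :
    ∃ s, (s = 1 ∨ s = -1) ∧ H.1.val ∈ involutions (adj n) s := by
  rw [← QuotientGroup.mk_mul, QuotientGroup.eq_one_iff] at hH
  have h1 := (mem_Sp_iff_adj n H.1).1 H.2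
  rcases hH with h | h
  · exact ⟨1, Or.inl rfl, h1, congrArg (fun A : Sp n => A.1.val) h⟩
  · exact ⟨-1, Or.inr rfl, h1, congrArg (fun A : Sp n => A.1.val) h⟩

variable {n} in
/-- The members of a strongly doubly reversible pair factor through three involutions. -/
theorem StronglyDoublyReversible.exists_involutions {g₁ g₂ : Sp n}
    (hg : StronglyDoublyReversible (g₁ : PSp n) (g₂ : PSp n)) :
    ∃ s₀ s₁ s₂ h k₁ k₂ : Matrix (Fin (n + 1)) (Fin (n + 1)) ℍ[ℝ],
      (s₀ = 1 ∨ s₀ = -1) ∧ (s₁ = 1 ∨ s₁ = -1) ∧ (s₂ = 1 ∨ s₂ = -1) ∧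
      h ∈ involutions (adj n) s₀ ∧ k₁ ∈ involutions (adj n) s₁ ∧ k₂ ∈ involutions (adj n) s₂ ∧
      (g₁.1.val, g₂.1.val) = (s₀ * h * k₁, s₀ * h * k₂) := by
  obtain ⟨h, h2, e₁, e₂⟩ := hg
  obtain ⟨H, rfl⟩ := QuotientGroup.mk_surjective h
  rw [pow_two] at h2
  -- Modulo signs `H⁻¹ = H`, so `(H g)² = (H g H⁻¹) g = g⁻¹ g`.
  have key : ∀ g : Sp n, (H : PSp n) * g * (H : PSp n)⁻¹ = (g : PSp n)⁻¹ →
      ((H * g : Sp n) : PSp n) * ((H * g : Sp n) : PSp n) = 1 := by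
    intro g hg
    rw [inv_eq_of_mul_eq_one_right h2] at hg
    rw [QuotientGroup.mk_mul, ← mul_assoc, hg, inv_mul_cancel]
  obtain ⟨s₀, hs₀, i₀⟩ := exists_mem_involutions h2
  obtain ⟨s₁, hs₁, i₁⟩ := exists_mem_involutions (key g₁ e₁)
  obtain ⟨s₂, hs₂, i₂⟩ := exists_mem_involutions (key g₂ e₂)
  refine ⟨s₀, s₁, s₂, _, _, _, hs₀, hs₁, hs₂, i₀, i₁, i₂, ?_⟩
  -- Since `H² = s₀`, the inverse of `H` is `s₀ H`.
  have hH : ∀ x, s₀ * H.1.val * (H.1.val * x) = x := by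
    intro x
    rw [mul_assoc, ← mul_assoc H.1.val, i₀.2, ← mul_assoc]
    rcases hs₀ with rfl | rfl <;> simp
  exact (Prod.ext (hH _) (hH _)).symm

/-- A nonzero finite measure on pairs of skew elements for which every translate of the set of
strongly doubly reversible pairs pulls back to a null set under the exponential. -/
theorem exists_measure_exp_preimage_null (hn : 1 ≤ n) :
    letI := borel (skewPart (adj n) × skewPart (adj n))
    ∃ ν : Measure (skewPart (adj n) × skewPart (adj n)), IsFiniteMeasure ν ∧ ν ≠ 0 ∧
      ∀ a b : Sp n, ν {p | StronglyDoublyReversible ((a * expSp n p.1 : Sp n) : PSp n)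
        ((b * expSp n p.2 : Sp n) : PSp n)} = 0 := by
  let : NormedRing (Matrix (Fin (n + 1)) (Fin (n + 1)) ℍ[ℝ]) := Matrix.linftyOpNormedRing
  let : NormedAlgebra ℝ (Matrix (Fin (n + 1)) (Fin (n + 1)) ℍ[ℝ]) := Matrix.linftyOpNormedAlgebra
  have hE := dimH_image_involutions_le (adj_mul n) (adj_one n) (a := (n + 1) * (n + 2))
    (fun s h hs hh => finrank_antiPart_adj_le n h hh.1
      (hs.imp (fun e => hh.2.trans e) fun e => hh.2.trans e))
  -- The comparison reduces to `3(n+2) < 2(2n+3)`, that is `0 < n`; equality holds at `n = 0`.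
  have hdim : 3 * ((n + 1) * (n + 2)) < Module.finrank ℝ (skewPart (adj n) × skewPart (adj n)) := by
    rw [Module.finrank_prod, finrank_skewPart_adj]
    nlinarith
  obtain ⟨ν, h1, h2, h3⟩ := exists_measure_exp_preimage_null_of_dimH_lt (skewPart (adj n))
    (hE.trans_lt (by exact_mod_cast hdim))
  exact ⟨ν, h1, h2, fun a b => measure_mono_null
    (fun p hp => StronglyDoublyReversible.exists_involutions hp) (h3 a.1 b.1)⟩

end Main
end QuatHyp

theorem theorem1p1 (n : ℕ) (hn : 1 ≤ n)
    [MeasurableSpace (QuatHyp.PSp n × QuatHyp.PSp n)] [BorelSpace (QuatHyp.PSp n × QuatHyp.PSp n)]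
    (μ : MeasureTheory.Measure (QuatHyp.PSp n × QuatHyp.PSp n)) [μ.IsHaarMeasure] :
    μ {p : QuatHyp.PSp n × QuatHyp.PSp n | QuatHyp.StronglyDoublyReversible p.1 p.2} = 0 := by
  let : MeasurableSpace (QuatHyp.skewPart (QuatHyp.adj n) × QuatHyp.skewPart (QuatHyp.adj n)) :=
    borel _
  have : BorelSpace (QuatHyp.skewPart (QuatHyp.adj n) × QuatHyp.skewPart (QuatHyp.adj n)) := ⟨rfl⟩
  obtain ⟨ν, hfin, hν, hnull⟩ := QuatHyp.exists_measure_exp_preimage_null n hn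
  have hcont : Continuous fun p : QuatHyp.skewPart (QuatHyp.adj n) ×
      QuatHyp.skewPart (QuatHyp.adj n) =>
        ((QuatHyp.expSp n p.1 : QuatHyp.PSp n), (QuatHyp.expSp n p.2 : QuatHyp.PSp n)) :=
    (QuotientGroup.continuous_mk.comp ((QuatHyp.continuous_expSp n).comp continuous_fst)).prodMk
      (QuotientGroup.continuous_mk.comp ((QuatHyp.continuous_expSp n).comp continuous_snd))
  refine QuatHyp.haar_eq_zero_of_translates_null μ ν hν hcont.measurable
    QuatHyp.measurableSet_stronglyDoublyReversible ?_
  rintro ⟨x, y⟩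
  obtain ⟨a, rfl⟩ := QuotientGroup.mk_surjective x
  obtain ⟨b, rfl⟩ := QuotientGroup.mk_surjective y
  exact hnull a b
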